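/- Let $\mathbf X\subset\mathbb R^n$ be compact (e.g. a box), let $\lambda$ be the Lebesgue measure on $\mathbf X$, and let $\mu$ be a Borel probability measure on $\mathbb R^p$ with compact support $\mathbf\Omega$. Let $g_1,\dots,g_m\in\mathbb R[\mathbf x,\omega]$ be polynomials, one of which is $M-\Vert(\mathbf x,\omega)\Vert^2$ for some $M>0$, and put $$\mathbf K=\{(\mathbf x,\omega)\in\mathbf X\times\mathbf\Omega:\ g_j(\mathbf x,\omega)\ge 0,\ j=1,\dots,m\},\qquad \mathbf K_{\mathbf x}=\{\omega\in\mathbf\Omega:(\mathbf x,\omega)\in\mathbf K\}.$$ For each $d\in\mathbb N$ consider the problem $$\inf_{p}\ \Big\{\int_{\mathbf X\times\mathbf\Omega}p\,d(\lambda\otimes\mu):\ p\in\mathbb R[\mathbf x,\omega],\ \deg p\le 2d,\ p \text{ is a sum of squares (SOS)},\ p\ge 1\text{ on }\mathbf K\Big\},\tag{1}$$ and its semidefinite version (2), in which "$p\ge1$ on $\mathbf K$" is replaced by "$p-1=\sigma_0+\sum_{j=1}^m\sigma_j g_j$ with SOS polynomials $\sigma_0,\sigma_1,\dots,\sigma_m$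 such that $\deg\sigma_0\le 2d$ and, for each $j\geq 1$, either $\sigma_j=0$ or $\deg\sigma_j\le 2(d-\lceil\deg g_j/2\rceil)$". For every $d\in\mathbb N$ let $p^*_d$ be an optimal solution of (1), or, for every $d\in\mathbb N$, let $p^*_d$ be an optimal solution of (2). In either case define $$h^*_d(\mathbf x)=\int_{\mathbf\Omega}p^*_d(\mathbf x,\omega)\,\mu(d\omega),\qquad \psi^*_d(\mathbf x)=h^*_d(\mathbf x)-\mu(\mathbf K_{\mathbf x}).$$ Then $\psi^*_d\ge0$ on $\mathbf X$ for every $d$, and $\psi^*_d\to0$ in $L^1(\mathbf X,\lambda)$ as $d\to\infty$. In particular $\psi^*_d\to0$ in $\lambda$-measure, and there is a subsequence $(\psi^*_{d_k})_{k\in\mathbb N}$ that converges to $0$ $\lambda$-almost uniformly: for every $\varepsilon>0$ there is a measurable set $B\subset\mathbf X$ with $\lambda(B)<\varepsilon$ such that $\psi^*_{d_k}\to0$ uniformly on $\mathbf X\setminus B$. -/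

import Mathlib

open MeasureTheory Filter Topology

/-- Real polynomials in the variables `(x, ω)`, with `x ∈ ℝⁿ` and `ω ∈ ℝᵖ`. -/
abbrev JointPoly (n p : ℕ) := MvPolynomial (Fin n ⊕ Fin p) ℝ

namespace JointPoly

variable {n p m : ℕ}

/-- The value `f(x, ω)`. -/
noncomputable def evalAt (f : JointPoly n p) (x : Fin n → ℝ) (ω : Fin p → ℝ) : ℝ :=
  MvPolynomial.eval (Sum.elim x ω) f

/-- The polynomial `‖(x, ω)‖² = ∑ xᵢ² + ∑ ωⱼ²` (Euclidean norm). -/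
noncomputable def normSq (n p : ℕ) : JointPoly n p :=
  ∑ i : Fin n ⊕ Fin p, MvPolynomial.X i ^ 2

/-- `K = {(x, ω) ∈ X × Ω : g_j(x, ω) ≥ 0 for all j}`. -/
def semialgSet (X : Set (Fin n → ℝ)) (Ω : Set (Fin p → ℝ)) (g : Fin m → JointPoly n p) :
    Set ((Fin n → ℝ) × (Fin p → ℝ)) :=
  {z | z.1 ∈ X ∧ z.2 ∈ Ω ∧ ∀ j, 0 ≤ (g j).evalAt z.1 z.2}

/-- The section `K_x = {ω ∈ Ω : (x, ω) ∈ K}`. -/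
def fiber (Ω : Set (Fin p → ℝ)) (K : Set ((Fin n → ℝ) × (Fin p → ℝ))) (x : Fin n → ℝ) :
    Set (Fin p → ℝ) :=
  {ω | ω ∈ Ω ∧ (x, ω) ∈ K}

/-- The criterion `∫_{X × Ω} f d(λ ⊗ μ)`, where `λ` is Lebesgue measure on `X`. -/
noncomputable def cost (X : Set (Fin n → ℝ)) (μ : Measure (Fin p → ℝ)) (f : JointPoly n p) : ℝ :=
  ∫ z, f.evalAt z.1 z.2 ∂((volume.restrict X).prod μ)

/-- Feasible polynomials of the dual problem of order `d`: sums of squares of degree at most `2d`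
which are at least `1` on `K`. -/
def dualFeasible (K : Set ((Fin n → ℝ) × (Fin p → ℝ))) (d : ℕ) : Set (JointPoly n p) :=
  {f | f.totalDegree ≤ 2 * d ∧ IsSumSq f ∧ ∀ z ∈ K, 1 ≤ f.evalAt z.1 z.2}

/-- `d_j = ⌈deg g_j / 2⌉`. -/
noncomputable def halfDegree (f : JointPoly n p) : ℕ := (f.totalDegree + 1) / 2

/-- Feasible polynomials of the conic (Lagrangian) dual of the order-`d` moment relaxation
`sup {y₀ : y + z = (λ ⊗ μ)-moments up to degree 2d, M_d(y) ⪰ 0, M_d(z) ⪰ 0,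
M_{d - d_j}(g_j y) ⪰ 0 for the j with d_j ≤ d}`.
The multiplier `f` of the moment equations is a sum of squares of degree at most `2d`, and
`f - 1 = σ₀ + ∑ σ_j g_j` with sums of squares `σ₀` of degree at most `2d` and `σ_j` of degree
at most `2 (d - d_j)`; the term `σ_j g_j` is absent when `d < d_j`. -/
def sdpDualFeasible (g : Fin m → JointPoly n p) (d : ℕ) : Set (JointPoly n p) :=
  {f | f.totalDegree ≤ 2 * d ∧ IsSumSq f ∧
    ∃ (σ₀ : JointPoly n p) (σ : Fin m → JointPoly n p),
      IsSumSq σ₀ ∧ σ₀.totalDegree ≤ 2 * d ∧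
      (∀ j, IsSumSq (σ j) ∧
        (σ j ≠ 0 → (σ j).totalDegree + 2 * (g j).halfDegree ≤ 2 * d)) ∧
      f - 1 = σ₀ + ∑ j, σ j * g j}

/-- `f` minimizes the criterion `∫_{X × Ω} f d(λ ⊗ μ)` over the set `F`. -/
def IsOptimal (X : Set (Fin n → ℝ)) (μ : Measure (Fin p → ℝ)) (F : Set (JointPoly n p))
    (f : JointPoly n p) : Prop :=
  f ∈ F ∧ ∀ q ∈ F, cost X μ f ≤ cost X μ q

/-- `h(x) = ∫_Ω f(x, ω) μ(dω)`. -/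
noncomputable def marginal (μ : Measure (Fin p → ℝ)) (f : JointPoly n p) (x : Fin n → ℝ) : ℝ :=
  ∫ ω in μ.support, f.evalAt x ω ∂μ

/-- `ψ(x) = h(x) - μ(K_x)`, where `h(x) = ∫_Ω f(x, ω) μ(dω)` and `Ω` is the support of `μ`. -/
noncomputable def excess (X : Set (Fin n → ℝ)) (μ : Measure (Fin p → ℝ))
    (g : Fin m → JointPoly n p) (f : JointPoly n p) (x : Fin n → ℝ) : ℝ :=
  f.marginal μ x - μ.real (fiber μ.support (semialgSet X μ.support g) x)

end JointPoly

/-! The excess is `∫ (p_d - 1_K) dμ`. Its integrand is nonnegative, because `p_d ≥ 1` on `K` and a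
sum of squares is nonnegative elsewhere. By Fubini its `L¹` norm is therefore the cost of `p_d`
minus `(λ ⊗ μ)(K)`. Since semidefinite feasibility implies feasibility in (1), both cases follow
once, for each `ε > 0`, some polynomial is semidefinite-feasible for all large `d` and costs at most
`(λ ⊗ μ)(K) + ε`.

Such a polynomial is a square `q²`: outer regularity, Urysohn and Stone–Weierstrass make it exceed
`1` strictly on `{g ≥ 0}` with integral close to the measure of that set
(`exists_sq_gt_one_integral_le`). Putinar's theorem (`mem_quadraticCone_of_pos`) then certifies `q²
- 1`, and the certificate has some finite degree.

Putinar's theorem is proved by convexity. An element outside an Archimedean quadratic module `Q` is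
nonpositive at some state of `Q`, hence at an extreme one. Extreme states are multiplicative, and
multiplicative functionals on polynomials are point evaluations. -/

/-! ### Archimedean quadratic modules -/

/-- A convex cone in an algebra that contains `1` and is stable under multiplication by squares, and
in which every element is bounded by a constant. -/
structure IsArchimedeanQuadraticModule {A : Type*} [CommRing A] [Algebra ℝ A]
    (Q : PointedCone ℝ A) : Prop where
  one_mem : 1 ∈ Q
  sq_mul_mem : ∀ a, ∀ q ∈ Q, a ^ 2 * q ∈ Q
  archimedean : ∀ a, ∃ N : ℝ, algebraMap ℝ A N - a ∈ Q

/-- The normalized linear functionals that are nonnegative on `Q`. -/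
def coneStates {A : Type*} [CommRing A] [Algebra ℝ A] (Q : PointedCone ℝ A) : Set (A → ℝ) :=
  {φ | ∃ L : A →ₗ[ℝ] ℝ, ⇑L = φ ∧ L 1 = 1 ∧ ∀ q ∈ Q, 0 ≤ L q}

/-- For `c > 0`, iteration gives `u k ≥ c * (u 0 / c) ^ (2 ^ k)`, which is unbounded if `u 0 > c`.
-/
theorem le_of_sq_le_mul_succ {u : ℕ → ℝ} {c D : ℝ} (hc : 0 ≤ c)
    (hsq : ∀ k, u k ^ 2 ≤ c * u (k + 1)) (hD : ∀ k, u k ≤ D) : u 0 ≤ c := by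
  by_contra! h
  have h0 := hsq 0
  rcases hc.eq_or_lt with rfl | hc
  · nlinarith
  have hr : 1 < u 0 / c := by rwa [one_lt_div hc]
  have hlow : ∀ k, c * (u 0 / c) ^ (2 ^ k) ≤ u k := by
    intro k
    induction k with
    | zero => simp [mul_div_cancel₀ _ hc.ne']
    | succ k ih =>
      have h1 : 0 ≤ c * (u 0 / c) ^ (2 ^ k) := by positivity
      have h2 : (c * (u 0 / c) ^ (2 ^ k)) ^ 2 ≤ c * u (k + 1) :=
        (pow_le_pow_left₀ h1 ih 2).trans (hsq k)
      rw [mul_pow, ← pow_mul, ← pow_succ, sq c, mul_assoc] at h2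
      exact le_of_mul_le_mul_left h2 hc
  obtain ⟨n, hn⟩ := pow_unbounded_of_one_lt (D / c) hr
  have h3 := (hlow n).trans (hD n)
  have h4 : (u 0 / c) ^ n ≤ (u 0 / c) ^ (2 ^ n) :=
    pow_le_pow_right₀ hr.le Nat.lt_two_pow_self.le
  rw [div_lt_iff₀ hc] at hn
  nlinarith

namespace IsArchimedeanQuadraticModule

variable {A : Type*} [CommRing A] [Algebra ℝ A] {Q : PointedCone ℝ A}

theorem smul_mem_cone {c : ℝ} (hc : 0 ≤ c) {q : A} (hq : q ∈ Q) : c • q ∈ Q :=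
  PointedCone.smul_mem Q hc hq

theorem sq_mem (hQ : IsArchimedeanQuadraticModule Q) (a : A) : a ^ 2 ∈ Q := by
  simpa using hQ.sq_mul_mem a 1 hQ.one_mem

theorem exists_abs_le (hQ : IsArchimedeanQuadraticModule Q) (a : A) :
    ∃ N : ℝ, ∀ L : A →ₗ[ℝ] ℝ, (∀ q ∈ Q, 0 ≤ L q) → |L a| ≤ N * L 1 := by
  obtain ⟨N, hN⟩ := hQ.archimedean a
  obtain ⟨N', hN'⟩ := hQ.archimedean (-a)
  refine ⟨max N N', fun L hL => ?_⟩
  have h1 := hL _ hQ.one_mem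
  have h2 := hL _ hN
  have h3 := hL _ hN'
  simp only [map_sub, map_neg, Algebra.algebraMap_eq_smul_one, map_smul, smul_eq_mul] at h2 h3
  have h4 : N * L 1 ≤ max N N' * L 1 := by gcongr; simp
  have h5 : N' * L 1 ≤ max N N' * L 1 := by gcongr; simp
  rw [abs_le]
  constructor <;> linarith

theorem exists_one_sub_sq_mem (hQ : IsArchimedeanQuadraticModule Q) (a : A) :
    ∃ c : ℝ, 0 < c ∧ 1 - (c • a) ^ 2 ∈ Q := by
  obtain ⟨N, hN⟩ := hQ.archimedean (a ^ 2)
  set R := max N 1 with hR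
  have hR0 : 0 < R := lt_of_lt_of_le one_pos (le_max_right _ _)
  refine ⟨(√R)⁻¹, by positivity, ?_⟩
  have h1 : R⁻¹ • (algebraMap ℝ A N - a ^ 2) ∈ Q := smul_mem_cone (by positivity) hN
  have h2 : (R⁻¹ * (R - N)) • (1 : A) ∈ Q :=
    smul_mem_cone (mul_nonneg (by positivity) (sub_nonneg.2 (le_max_left _ _))) hQ.one_mem
  have h3 := Q.add_mem h1 h2
  convert h3 using 1
  rw [smul_pow, inv_pow, Real.sq_sqrt hR0.le, Algebra.algebraMap_eq_smul_one, smul_sub, smul_smul,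
    mul_sub, inv_mul_cancel₀ hR0.ne', sub_smul, one_smul]
  abel

/-- The product `(1 - a ^ 2) * q` need not lie in `Q`, so positivity of `L` does not give this
directly. Instead Cauchy–Schwarz for the form `(x, y) ↦ L (x * y * q)` is iterated along the powers
`a ^ 2 ^ (k + 1)`; boundedness of their values then removes any excess over `L q`. -/
theorem map_sq_mul_le (hQ : IsArchimedeanQuadraticModule Q) {L : A →ₗ[ℝ] ℝ}
    (hL : ∀ q ∈ Q, 0 ≤ L q) {a q : A} (ha : 1 - a ^ 2 ∈ Q) (hq : q ∈ Q) :
    L (a ^ 2 * q) ≤ L q := by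
  have hpow : ∀ k : ℕ, L ((a ^ k) ^ 2) ≤ L 1 := by
    intro k
    induction k with
    | zero => simp
    | succ k ih =>
      have h := hL _ (hQ.sq_mul_mem (a ^ k) _ ha)
      rw [show (a ^ k) ^ 2 * (1 - a ^ 2) = (a ^ k) ^ 2 - (a ^ (k + 1)) ^ 2 by ring, map_sub] at h
      linarith
  have hcs : ∀ x : A, L (x * q) ^ 2 ≤ L q * L (x ^ 2 * q) := by
    intro x
    have hd : ∀ t : ℝ, 0 ≤ L q * (t * t) + (-2 * L (x * q)) * t + L (x ^ 2 * q) := by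
      intro t
      have h := hL _ (hQ.sq_mul_mem (x - t • 1) _ hq)
      have e : (x - t • 1) ^ 2 * q = x ^ 2 * q - (2 * t) • (x * q) + (t * t) • q := by
        simp only [Algebra.smul_def, map_mul, map_ofNat]
        ring
      rw [e] at h
      simp only [map_sub, map_add, map_smul, smul_eq_mul] at h
      linarith
    have := discrim_le_zero hd
    rw [discrim] at this
    linarith
  have key := le_of_sq_le_mul_succ (u := fun k => L ((a ^ 2 ^ (k + 1)) * q)) (c := L q)
    (D := (L 1 + L (q ^ 2)) / 2) (hL q hq) ?_ ?_
  · simpa using key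
  · intro k
    have := hcs (a ^ 2 ^ (k + 1))
    rwa [← pow_mul, ← pow_succ] at this
  · intro k
    -- The uniform bound `D` comes from expanding this square and from `hpow`.
    have h := hL _ (hQ.sq_mem (a ^ 2 ^ (k + 1) - q))
    have e : (a ^ 2 ^ (k + 1) - q) ^ 2
        = (a ^ 2 ^ (k + 1)) ^ 2 - (2 : ℝ) • (a ^ 2 ^ (k + 1) * q) + q ^ 2 := by
      rw [Algebra.smul_def, map_ofNat]; ring
    rw [e] at h
    simp only [map_sub, map_add, map_smul, smul_eq_mul] at h
    have := hpow (2 ^ (k + 1))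
    linarith

theorem eq_zero_of_map_one_eq_zero (hQ : IsArchimedeanQuadraticModule Q) {L : A →ₗ[ℝ] ℝ}
    (hL : ∀ q ∈ Q, 0 ≤ L q) (h1 : L 1 = 0) (a : A) : L a = 0 := by
  obtain ⟨N, hN⟩ := hQ.exists_abs_le a
  simpa [h1] using hN L hL

/-- If `0 < L₁ 1 < 1`, then `L` is a proper convex combination of the normalizations of `L₁` and `L
- L₁`, so extremality identifies them. In the two boundary cases one of these functionals kills `1`,
hence vanishes. -/
theorem eq_smul_of_le_extremePoint (hQ : IsArchimedeanQuadraticModule Q) {L L₁ : A →ₗ[ℝ] ℝ}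
    (hL : ⇑L ∈ (coneStates Q).extremePoints ℝ) (hL₁ : ∀ q ∈ Q, 0 ≤ L₁ q)
    (hle : ∀ q ∈ Q, L₁ q ≤ L q) (a : A) : L₁ a = L₁ 1 * L a := by
  obtain ⟨⟨L', hL', hL'1, hL'Q⟩, hext⟩ := mem_extremePoints.1 hL
  obtain rfl : L' = L := DFunLike.coe_injective hL'
  have hd : ∀ q ∈ Q, 0 ≤ (L' - L₁) q := fun q hq => by simpa using hle q hq
  have h0 := hL₁ 1 hQ.one_mem
  have h1 := hle 1 hQ.one_mem
  rw [hL'1] at h1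
  rcases h0.eq_or_lt with h0 | h0
  · rw [hQ.eq_zero_of_map_one_eq_zero hL₁ h0.symm, ← h0, zero_mul]
  rcases h1.eq_or_lt with h1 | h1
  · have := hQ.eq_zero_of_map_one_eq_zero hd (by simp [h1, hL'1]) a
    rw [LinearMap.sub_apply] at this
    rw [h1, one_mul]; linarith
  set t := L₁ 1
  have h1' : 0 < 1 - t := by linarith
  have hs₁ : ⇑(t⁻¹ • L₁) ∈ coneStates Q :=
    ⟨_, rfl, by simpa using inv_mul_cancel₀ h0.ne', fun q hq => by
      simpa using mul_nonneg (inv_nonneg.2 h0.le) (hL₁ q hq)⟩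
  have hs₂ : ⇑((1 - t)⁻¹ • (L' - L₁)) ∈ coneStates Q :=
    ⟨_, rfl, by simpa [hL'1] using inv_mul_cancel₀ h1'.ne', fun q hq => by
      simpa using mul_nonneg (inv_nonneg.2 h1'.le) (hd q hq)⟩
  have := (hext _ hs₁ _ hs₂ ⟨t, 1 - t, h0, h1', by ring, by
    ext x
    simp
    field_simp
    ring⟩).1
  have := congrFun this a
  simp only [LinearMap.smul_apply, smul_eq_mul] at this
  rw [← this]
  field_simp

/-- After scaling `x`, the functional `y ↦ L (x ^ 2 * y)` is dominated by `L`, hence proportional to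
it. Comparing `x = a + 1` with `x = a` passes from squares to arbitrary factors. -/
theorem map_mul_of_extremePoint (hQ : IsArchimedeanQuadraticModule Q) {L : A →ₗ[ℝ] ℝ}
    (hL : ⇑L ∈ (coneStates Q).extremePoints ℝ) (a b : A) : L (a * b) = L a * L b := by
  obtain ⟨L', hL', hL1, hLQ⟩ := hL.1
  obtain rfl : L' = L := DFunLike.coe_injective hL'
  have hsq : ∀ x y : A, L' (x ^ 2 * y) = L' (x ^ 2) * L' y := by
    intro x y
    obtain ⟨c, hc, hcx⟩ := hQ.exists_one_sub_sq_mem x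
    have h := hQ.eq_smul_of_le_extremePoint (L₁ := L' ∘ₗ LinearMap.mulLeft ℝ ((c • x) ^ 2)) hL
      (fun q hq => hLQ _ (hQ.sq_mul_mem _ q hq)) (fun q hq => hQ.map_sq_mul_le hLQ hcx hq) y
    simp only [LinearMap.comp_apply, LinearMap.mulLeft_apply, mul_one, smul_pow,
      smul_mul_assoc, map_smul, smul_eq_mul, mul_assoc] at h
    exact mul_left_cancel₀ (pow_pos hc 2).ne' h
  have h1 := hsq (a + 1) b
  have h2 := hsq a b
  have e1 : (a + 1) ^ 2 * b = a ^ 2 * b + (2 : ℝ) • (a * b) + b := by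
    rw [Algebra.smul_def, map_ofNat]; ring
  have e2 : (a + 1) ^ 2 = a ^ 2 + (2 : ℝ) • a + 1 := by
    rw [Algebra.smul_def, map_ofNat]; ring
  rw [e1, e2] at h1
  simp only [map_add, map_smul, smul_eq_mul, hL1] at h1
  linarith

theorem isCompact_coneStates (hQ : IsArchimedeanQuadraticModule Q) : IsCompact (coneStates Q) := by
  choose N hN using hQ.exists_abs_le
  refine IsCompact.of_isClosed_subset (isCompact_univ_pi fun a => isCompact_Icc (a := -N a)
    (b := N a)) ?_ ?_
  · have e : coneStates Q = Set.range ((↑) : (A →ₗ[ℝ] ℝ) → A → ℝ) ∩ {φ | φ 1 = 1} ∩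
        ⋂ q ∈ Q, {φ | 0 ≤ φ q} := by
      ext φ
      simp only [coneStates, Set.mem_ofPred_eq, Set.mem_inter_iff, Set.mem_range, Set.mem_iInter]
      constructor
      · rintro ⟨L, rfl, h1, h2⟩
        exact ⟨⟨⟨L, rfl⟩, h1⟩, h2⟩
      · rintro ⟨⟨⟨L, rfl⟩, h1⟩, h2⟩
        exact ⟨L, rfl, h1, h2⟩
    rw [e]
    exact ((LinearMap.isClosed_range_coe A ℝ (RingHom.id ℝ)).inter
      (isClosed_eq (continuous_apply 1) continuous_const)).inter
      (isClosed_biInter fun q _ => isClosed_le continuous_const (continuous_apply q))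
  · rintro _ ⟨L, rfl, h1, h2⟩ a -
    have := hN a L h2
    rw [h1, mul_one, abs_le] at this
    exact this

/-- Adjoining `-f` to `Q` does not produce `-1`, so `c • 1 ↦ c` is nonnegative on the multiples of
`1` in the larger cone. The Archimedean property is the cofinality that the Riesz extension theorem
needs. -/
theorem exists_state_nonpos (hQ : IsArchimedeanQuadraticModule Q) {f : A} (hf : f ∉ Q) :
    ∃ φ ∈ coneStates Q, φ f ≤ 0 := by
  have hone : (1 : A) ≠ 0 := by
    intro h
    have : f = 0 := by rw [← mul_one f, h, mul_zero]
    exact hf (this ▸ Q.zero_mem)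
  -- With `-1` in `Q`, every constant is in `Q`, and `N + f ∈ Q` would give `f ∈ Q`.
  have hneg : -(1 : A) ∉ Q := by
    intro h
    obtain ⟨N, hN⟩ := hQ.archimedean (-f)
    have h1 : (max N 0) • -(1 : A) ∈ Q := smul_mem_cone (le_max_right _ _) h
    have h2 : (max N 0 - N) • (1 : A) ∈ Q :=
      smul_mem_cone (sub_nonneg.2 (le_max_left _ _)) hQ.one_mem
    have h3 := Q.add_mem (Q.add_mem hN h1) h2
    refine hf ?_
    convert h3 using 1
    rw [Algebra.algebraMap_eq_smul_one, sub_smul, smul_neg]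
    abel
  set Q' : PointedCone ℝ A := Q ⊔ Submodule.span _ {-f} with hQ'
  have hQQ' : Q ≤ Q' := le_sup_left
  have hneg' : -(1 : A) ∉ Q' := by
    intro h
    obtain ⟨q, hq, z, hz, hqz⟩ := Submodule.mem_sup.1 h
    obtain ⟨⟨c, hc⟩, rfl⟩ := Submodule.mem_span_singleton.1 hz
    have hqz' : q + c • (-f) = -1 := hqz
    have hcf : c • f = q + 1 := by
      rw [smul_neg] at hqz'
      linear_combination (-1 : A) * hqz'
    have hcfQ : c • f ∈ Q := hcf ▸ Q.add_mem hq hQ.one_mem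
    rcases hc.eq_or_lt with rfl | hc
    · refine hneg ?_
      rw [zero_smul] at hcf
      rwa [show -(1 : A) = q by linear_combination hcf]
    · refine hf ?_
      have := smul_mem_cone (inv_nonneg.2 hc.le) hcfQ
      rwa [smul_smul, inv_mul_cancel₀ hc.ne', one_smul] at this
  let ℓ : A →ₗ.[ℝ] ℝ := LinearPMap.mkSpanSingleton 1 1 hone
  have hnn : ∀ x : ℓ.domain, (x : A) ∈ Q' →
      0 ≤ ℓ x := by
    rintro ⟨x, hx⟩ hxQ
    obtain ⟨c, rfl⟩ := Submodule.mem_span_singleton.1 hx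
    have : ℓ ⟨c • 1, hx⟩ = c • 1 :=
      LinearPMap.mkSpanSingleton'_apply _ _ _ _ _
    rw [this]
    by_contra! hc
    have hc : c < 0 := by simpa using hc
    refine hneg' ?_
    have := smul_mem_cone (c := (-c)⁻¹) (by rw [inv_nonneg]; linarith) hxQ
    simp only [smul_smul] at this
    rwa [inv_neg, neg_mul, inv_mul_cancel₀ hc.ne, neg_smul, one_smul] at this
  have hdense : ∀ y, ∃ x : ℓ.domain,
      (x : A) + y ∈ Q' := by
    intro y
    obtain ⟨N, hN⟩ := hQ.archimedean (-y)
    refine ⟨⟨N • 1, Submodule.smul_mem _ _ (Submodule.mem_span_singleton_self 1)⟩, hQQ' ?_⟩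
    simpa [Algebra.algebraMap_eq_smul_one] using hN
  obtain ⟨L, hL1, hL2⟩ := riesz_extension Q' _ hnn hdense
  refine ⟨L, ⟨L, rfl, ?_, fun q hq => hL2 q (hQQ' hq)⟩, ?_⟩
  · have := hL1 ⟨1, Submodule.mem_span_singleton_self 1⟩
    exact this.trans (LinearPMap.mkSpanSingleton_apply ℝ ℝ hone 1)
  · have := hL2 (-f) (le_sup_right (a := Q) (Submodule.mem_span_singleton_self _))
    rw [map_neg] at this
    linarith

/-- The representation theorem for Archimedean quadratic modules. -/
theorem mem_of_forall_algHom_pos (hQ : IsArchimedeanQuadraticModule Q) {f : A}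
    (hf : ∀ φ : A →ₐ[ℝ] ℝ, (∀ q ∈ Q, 0 ≤ φ q) → 0 < φ f) : f ∈ Q := by
  by_contra hfQ
  obtain ⟨φ₀, hφ₀, hφ₀f⟩ := hQ.exists_state_nonpos hfQ
  -- The sign turns the exposed face of maximizers into the states minimizing `φ f`. An extreme
  -- point of this face is extreme among all states.
  let ev : StrongDual ℝ (A → ℝ) := -ContinuousLinearMap.proj f
  have hexp : IsExposed ℝ (coneStates Q) (ev.toExposed (coneStates Q)) :=
    ContinuousLinearMap.toExposed.isExposed
  have hcomp := hexp.isCompact hQ.isCompact_coneStates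
  obtain ⟨ψ, hψ, hψmin⟩ := hQ.isCompact_coneStates.exists_isMinOn ⟨φ₀, hφ₀⟩
    (f := fun φ => φ f) (continuous_apply f).continuousOn
  obtain ⟨χ, hχ⟩ := hcomp.extremePoints_nonempty ⟨ψ, hψ, fun y hy => by
    simpa [ev] using hψmin hy⟩
  have hχext := hexp.isExtreme.extremePoints_subset_extremePoints hχ
  obtain ⟨L, rfl, hL1, hLQ⟩ := hχext.1
  have hle : L f ≤ 0 := by
    have := hχ.1.2 φ₀ hφ₀
    simp only [ev, neg_apply, ContinuousLinearMap.proj_apply] at this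
    linarith
  exact absurd (hf (AlgHom.ofLinearMap L hL1 (hQ.map_mul_of_extremePoint hχext)) hLQ)
    (by simpa using hle)

end IsArchimedeanQuadraticModule

/-! ### Putinar's Positivstellensatz -/

/-- The quadratic module generated by a finite family. -/
def quadraticCone {A : Type*} [CommRing A] [Algebra ℝ A] {m : ℕ} (g : Fin m → A) :
    PointedCone ℝ A where
  carrier := {f | ∃ (σ₀ : A) (σ : Fin m → A), IsSumSq σ₀ ∧ (∀ j, IsSumSq (σ j)) ∧
    f = σ₀ + ∑ j, σ j * g j}
  zero_mem' := ⟨0, 0, .zero, fun _ => .zero, by simp⟩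
  add_mem' := by
    rintro _ _ ⟨σ₀, σ, h₀, h, rfl⟩ ⟨τ₀, τ, k₀, k, rfl⟩
    refine ⟨σ₀ + τ₀, σ + τ, h₀.add k₀, fun j => (h j).add (k j), ?_⟩
    simp only [Pi.add_apply, add_mul, Finset.sum_add_distrib]
    ring
  smul_mem' := by
    rintro ⟨c, hc⟩ _ ⟨σ₀, σ, h₀, h, rfl⟩
    have hcs : IsSumSq (algebraMap ℝ A c) := by
      rw [← Real.mul_self_sqrt hc, map_mul]
      exact .mul_self _
    refine ⟨algebraMap ℝ A c * σ₀, fun j => algebraMap ℝ A c * σ j, hcs.mul h₀,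
      fun j => hcs.mul (h j), ?_⟩
    change c • (σ₀ + ∑ j, σ j * g j) = _
    rw [Algebra.smul_def, mul_add, Finset.mul_sum]
    simp only [mul_assoc]

theorem one_mem_quadraticCone {A : Type*} [CommRing A] [Algebra ℝ A] {m : ℕ} (g : Fin m → A) :
    1 ∈ quadraticCone g :=
  ⟨1, 0, .one, fun _ => .zero, by simp⟩

theorem sq_mul_mem_quadraticCone {A : Type*} [CommRing A] [Algebra ℝ A] {m : ℕ} (g : Fin m → A)
    (a : A) {q : A} (hq : q ∈ quadraticCone g) : a ^ 2 * q ∈ quadraticCone g := by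
  obtain ⟨σ₀, σ, h₀, h, rfl⟩ := hq
  have ha : IsSumSq (a ^ 2) := sq a ▸ .mul_self a
  refine ⟨a ^ 2 * σ₀, fun j => a ^ 2 * σ j, ha.mul h₀, fun j => ha.mul (h j), ?_⟩
  simp only [mul_add, Finset.mul_sum, mul_assoc]

theorem generator_mem_quadraticCone {A : Type*} [CommRing A] [Algebra ℝ A] {m : ℕ} (g : Fin m → A)
    (j : Fin m) : g j ∈ quadraticCone g := by
  classical
  refine ⟨0, Pi.single j 1, .zero, fun i => ?_, ?_⟩
  · rcases eq_or_ne i j with rfl | h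
    · simp
    · simp [h]
  · simp [Pi.single_apply]

namespace MvPolynomial

variable {ι : Type*} [Fintype ι]

/-- The elements bounded on both sides by constants modulo `Q` form a subring: closure under squares
is an explicit identity, and products follow by polarization. It contains the constants and, by the
ball condition, the variables. -/
theorem isArchimedeanQuadraticModule_of_ball {Q : PointedCone ℝ (MvPolynomial ι ℝ)}
    (hone : 1 ∈ Q) (hsq : ∀ a, ∀ q ∈ Q, a ^ 2 * q ∈ Q) {M : ℝ}
    (hM : C M - ∑ i : ι, X i ^ 2 ∈ Q) : IsArchimedeanQuadraticModule Q := by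
  classical
  have hsq1 : ∀ a, a ^ 2 ∈ Q := fun a => by simpa using hsq a 1 hone
  have hC : ∀ c : ℝ, 0 ≤ c → ∀ q ∈ Q, C c * q ∈ Q := fun c hc q hq => by
    rw [← smul_eq_C_mul]; exact PointedCone.smul_mem Q hc hq
  have hC1 : ∀ c : ℝ, 0 ≤ c → (C c : MvPolynomial ι ℝ) ∈ Q := fun c hc => by
    simpa using hC c hc 1 hone
  suffices h : ∀ p : MvPolynomial ι ℝ, ∃ N : ℝ, 0 < N ∧ C N - p ∈ Q ∧ C N + p ∈ Q from
    ⟨hone, hsq, fun a => let ⟨N, _, hN, _⟩ := h a; ⟨N, hN⟩⟩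
  have hsquare : ∀ p : MvPolynomial ι ℝ, (∃ N : ℝ, 0 < N ∧ C N - p ∈ Q ∧ C N + p ∈ Q) →
      ∃ N : ℝ, 0 < N ∧ C N - p ^ 2 ∈ Q ∧ C N + p ^ 2 ∈ Q := by
    rintro p ⟨N, hN, h1, h2⟩
    refine ⟨N ^ 2, by positivity, ?_, Q.add_mem (hC1 _ (by positivity)) (hsq1 p)⟩
    have h3 := hC (2 * N)⁻¹ (by positivity) _ (Q.add_mem (hsq (C N - p) _ h2) (hsq (C N + p) _ h1))
    convert h3 using 1
    have e : (C N - p) ^ 2 * (C N + p) + (C N + p) ^ 2 * (C N - p)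
        = C (2 * N) * (C N ^ 2 - p ^ 2) := by
      rw [C_mul, show (C (2 : ℝ) : MvPolynomial ι ℝ) = 2 from map_ofNat C 2]; ring
    rw [e, ← mul_assoc, ← C_mul, inv_mul_cancel₀ (by positivity), C_1, one_mul, C_pow]
  have hadd : ∀ p q : MvPolynomial ι ℝ, (∃ N : ℝ, 0 < N ∧ C N - p ∈ Q ∧ C N + p ∈ Q) →
      (∃ N : ℝ, 0 < N ∧ C N - q ∈ Q ∧ C N + q ∈ Q) →
      ∃ N : ℝ, 0 < N ∧ C N - (p + q) ∈ Q ∧ C N + (p + q) ∈ Q := by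
    rintro p q ⟨N, hN, h1, h2⟩ ⟨N', hN', h1', h2'⟩
    refine ⟨N + N', by positivity, ?_, ?_⟩
    · convert Q.add_mem h1 h1' using 1
      rw [C_add]; ring
    · convert Q.add_mem h2 h2' using 1
      rw [C_add]; ring
  have hneg : ∀ p : MvPolynomial ι ℝ, (∃ N : ℝ, 0 < N ∧ C N - p ∈ Q ∧ C N + p ∈ Q) →
      ∃ N : ℝ, 0 < N ∧ C N - (-p) ∈ Q ∧ C N + (-p) ∈ Q := by
    rintro p ⟨N, hN, h1, h2⟩
    exact ⟨N, hN, by rwa [sub_neg_eq_add], by rwa [← sub_eq_add_neg]⟩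
  have hconst : ∀ c : ℝ, ∃ N : ℝ, 0 < N ∧ C N - (C c : MvPolynomial ι ℝ) ∈ Q ∧
      C N + (C c : MvPolynomial ι ℝ) ∈ Q := fun c => by
    refine ⟨|c| + 1, by positivity, ?_, ?_⟩
    · rw [← C_sub]
      exact hC1 _ (by linarith [le_abs_self c])
    · rw [← C_add]
      exact hC1 _ (by linarith [neg_abs_le c])
  have hscale : ∀ (c : ℝ) (p : MvPolynomial ι ℝ), 0 < c →
      (∃ N : ℝ, 0 < N ∧ C N - p ∈ Q ∧ C N + p ∈ Q) →
      ∃ N : ℝ, 0 < N ∧ C N - C c * p ∈ Q ∧ C N + C c * p ∈ Q := by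
    rintro c p hc ⟨N, hN, h1, h2⟩
    refine ⟨c * N, by positivity, ?_, ?_⟩
    · rw [C_mul, ← mul_sub]; exact hC c hc.le _ h1
    · rw [C_mul, ← mul_add]; exact hC c hc.le _ h2
  have hmul : ∀ p q : MvPolynomial ι ℝ, (∃ N : ℝ, 0 < N ∧ C N - p ∈ Q ∧ C N + p ∈ Q) →
      (∃ N : ℝ, 0 < N ∧ C N - q ∈ Q ∧ C N + q ∈ Q) →
      ∃ N : ℝ, 0 < N ∧ C N - (p * q) ∈ Q ∧ C N + (p * q) ∈ Q := by
    intro p q hp hq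
    have h := hscale (1 / 4) _ (by norm_num) (hadd _ _ (hsquare _ (hadd p q hp hq))
      (hneg _ (hsquare _ (hadd p (-q) hp (hneg q hq)))))
    have e : C (1 / 4 : ℝ) * ((p + q) ^ 2 + -(p + -q) ^ 2) = p * q := by
      have h4 : (C (1 / 4 : ℝ) : MvPolynomial ι ℝ) * 4 = 1 := by
        rw [← map_ofNat (C : ℝ →+* MvPolynomial ι ℝ) 4, ← C_mul]; norm_num
      linear_combination (p * q) * h4
    rwa [e] at h
  intro p
  induction p using MvPolynomial.induction_on with
  | C a => exact hconst a
  | add p q hp hq => exact hadd p q hp hq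
  | mul_X p i hp =>
    -- Completing the square: `|M| + 1 ∓ X i = (M - X i ^ 2) + (X i ∓ 1/2) ^ 2 + (|M| - M + 3/4)`.
    refine hmul p _ hp ⟨|M| + 1, by positivity, ?_⟩
    have hXi : C M - X i ^ 2 ∈ Q := by
      have : ∑ j ∈ Finset.univ.erase i, (X j : MvPolynomial ι ℝ) ^ 2 ∈ Q :=
        Q.sum_mem fun j _ => hsq1 _
      convert Q.add_mem hM this using 1
      rw [← Finset.add_sum_erase _ _ (Finset.mem_univ i)]
      ring
    have hc := hC1 (|M| - M + 3 / 4) (by linarith [le_abs_self M])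
    have h2 : (C (1 / 2 : ℝ) : MvPolynomial ι ℝ) * 2 = 1 := by
      rw [← map_ofNat (C : ℝ →+* MvPolynomial ι ℝ) 2, ← C_mul]; norm_num
    have h4 : (C (1 / 2 : ℝ) : MvPolynomial ι ℝ) ^ 2 + C (3 / 4) = 1 := by
      rw [← C_pow, ← C_add]; norm_num
    constructor
    · convert Q.add_mem (Q.add_mem hXi (hsq1 (X i - C (1 / 2)))) hc using 1
      simp only [C_add, C_sub, C_1]
      linear_combination (X i : MvPolynomial ι ℝ) * h2 - h4
    · convert Q.add_mem (Q.add_mem hXi (hsq1 (X i + C (1 / 2)))) hc using 1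
      simp only [C_add, C_sub, C_1]
      linear_combination -(X i : MvPolynomial ι ℝ) * h2 - h4

/-- **Putinar's Positivstellensatz.** -/
theorem mem_quadraticCone_of_pos {m : ℕ} {g : Fin m → MvPolynomial ι ℝ} {j₀ : Fin m} {M : ℝ}
    (hg : g j₀ = C M - ∑ i : ι, X i ^ 2) {f : MvPolynomial ι ℝ}
    (hf : ∀ y : ι → ℝ, (∀ j, 0 ≤ eval y (g j)) → 0 < eval y f) : f ∈ quadraticCone g := by
  refine (isArchimedeanQuadraticModule_of_ball (one_mem_quadraticCone g)
    (fun a q hq => sq_mul_mem_quadraticCone g a hq)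
    (hg ▸ generator_mem_quadraticCone g j₀)).mem_of_forall_algHom_pos fun φ hφ => ?_
  -- An algebra homomorphism is evaluation at the point formed by the images of the variables.
  have e : ∀ p, φ p = eval (fun i => φ (X i)) p := fun p => by
    conv_lhs => rw [aeval_unique φ]
    rw [← coe_aeval_eq_eval]
    rfl
  rw [e]
  exact hf _ fun j => e (g j) ▸ hφ _ (generator_mem_quadraticCone g j)

end MvPolynomial

/-! ### Approximation of indicators by squares of polynomials -/

namespace MvPolynomial

variable {ι : Type*}

/-- Uniform approximation of continuous functions on compact sets by polynomials. -/
theorem exists_eval_near {S : Set (ι → ℝ)} (hS : IsCompact S) (f : C(ι → ℝ, ℝ)) {ε : ℝ}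
    (hε : 0 < ε) : ∃ q : MvPolynomial ι ℝ, ∀ y ∈ S, |eval y q - f y| < ε := by
  let Φ : MvPolynomial ι ℝ →ₐ[ℝ] C(ι → ℝ, ℝ) :=
    aeval fun i => (⟨fun y => y i, continuous_apply i⟩ : C(ι → ℝ, ℝ))
  have hΦ : ∀ q y, Φ q y = eval y q := by
    intro q y
    induction q using MvPolynomial.induction_on with
    | C a => simp [Φ]
    | add p q hp hq => simp [hp, hq]
    | mul_X p i hp => simp [hp]; simp [Φ]
  have hsep : Φ.range.SeparatesPoints := by
    intro x y hxy
    obtain ⟨i, hi⟩ := Function.ne_iff.1 hxy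
    exact ⟨_, ⟨Φ (X i), ⟨X i, rfl⟩, rfl⟩, by simpa [hΦ] using hi⟩
  obtain ⟨g, ⟨q, rfl⟩, hg⟩ :=
    ContinuousMap.exists_mem_subalgebra_near_continuous_of_isCompact_of_separatesPoints hsep f hS hε
  exact ⟨q, fun y hy => by simpa [hΦ, Real.norm_eq_abs, abs_sub_comm] using hg y hy⟩

variable [Fintype ι]

theorem integrable_eval {ν : Measure (ι → ℝ)} [IsFiniteMeasure ν] {S : Set (ι → ℝ)}
    (hS : IsCompact S) (hν : ∀ᵐ y ∂ν, y ∈ S) (q : MvPolynomial ι ℝ) :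
    Integrable (fun y => eval y q) ν := by
  have := (continuous_eval q).continuousOn.integrableOn_compact (μ := ν) hS
  rwa [IntegrableOn, Measure.restrict_eq_self_of_ae_mem hν] at this

theorem exists_sq_gt_one_integral_le {ν : Measure (ι → ℝ)} [IsFiniteMeasure ν]
    {S K : Set (ι → ℝ)} (hS : IsCompact S) (hν : ∀ᵐ y ∂ν, y ∈ S) (hK : IsCompact K) {ε : ℝ}
    (hε : 0 < ε) : ∃ q : MvPolynomial ι ℝ, (∀ y ∈ K, 1 < eval y q ^ 2) ∧
      ∫ y, eval y (q ^ 2) ∂ν ≤ ν.real K + ε := by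
  obtain ⟨U, hKU, hU, hUν⟩ := K.exists_isOpen_lt_add (μ := ν) (measure_ne_top ν K)
    (ε := ENNReal.ofReal (ε / 2)) (by simpa using hε)
  have hUν' : ν.real U ≤ ν.real K + ε / 2 := by
    have := ENNReal.toReal_mono (by finiteness) hUν.le
    rwa [ENNReal.toReal_add (by finiteness) (by finiteness),
      ENNReal.toReal_ofReal (by positivity)] at this
  obtain ⟨f, hf0, hf1, hf⟩ := exists_continuous_zero_one_of_isClosed hU.isClosed_compl hK.isClosed
    (Set.disjoint_compl_left_iff_subset.2 hKU)
  set V := ν.real Set.univ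
  have hV : 0 ≤ V := measureReal_nonneg
  obtain ⟨δ, hδ, hδ1, hδV⟩ : ∃ δ : ℝ, 0 < δ ∧ δ ≤ 1 ∧ 15 * δ * V ≤ ε / 2 := by
    refine ⟨min 1 (ε / (30 * (V + 1))), by positivity, min_le_left _ _, ?_⟩
    calc 15 * min 1 (ε / (30 * (V + 1))) * V ≤ 15 * (ε / (30 * (V + 1))) * (V + 1) := by
          gcongr
          · exact min_le_right _ _
          · linarith
      _ = ε / 2 := by field_simp; norm_num
  -- The shift by `2 * δ` gives `f + δ < q < f + 3 * δ`. So `q > 1` on `K`, and since `0 ≤ f ≤ 1`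
  -- and `δ ≤ 1`, `q ^ 2 ≤ f + 15 * δ` on `S`.
  obtain ⟨q, hq⟩ := exists_eval_near (hS.union hK) (f + ContinuousMap.const _ (2 * δ)) hδ
  refine ⟨q, fun y hy => ?_, ?_⟩
  · have h := (abs_lt.1 (hq y (Or.inr hy))).1
    have h1 : f y = 1 := hf1 hy
    simp only [ContinuousMap.add_apply, ContinuousMap.const_apply, h1] at h
    nlinarith
  · have hbound : ∀ᵐ y ∂ν, eval y (q ^ 2) ≤ U.indicator 1 y + 15 * δ := by
      filter_upwards [hν] with y hy
      have h := abs_lt.1 (hq y (Or.inl hy))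
      have h01 := hf y
      simp only [ContinuousMap.add_apply, ContinuousMap.const_apply] at h
      have hfU : f y ≤ U.indicator 1 y := by
        by_cases hyU : y ∈ U
        · simpa [hyU] using h01.2
        · simpa [hyU] using (hf0 hyU).le
      have h0 := h01.1
      have h1 := h01.2
      rw [map_pow]
      have : eval y q ^ 2 ≤ (f y + 3 * δ) ^ 2 := by
        apply sq_le_sq' <;> linarith
      nlinarith
    have hUint : Integrable (U.indicator (1 : (ι → ℝ) → ℝ)) ν :=
      (integrable_const 1).indicator hU.measurableSet
    calc ∫ y, eval y (q ^ 2) ∂ν ≤ ∫ y, (U.indicator 1 y + 15 * δ) ∂ν :=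
          integral_mono_ae (integrable_eval hS hν _) (hUint.add (integrable_const _)) hbound
      _ = ν.real U + 15 * δ * V := by
          rw [integral_add hUint (integrable_const _), integral_indicator_one hU.measurableSet,
            integral_const, smul_eq_mul, mul_comm]
      _ ≤ ν.real K + ε := by linarith

end MvPolynomial

/-! ### Convergence of the hierarchies -/

theorem MvPolynomial.eval_nonneg_of_isSumSq {ι : Type*} {f : MvPolynomial ι ℝ} (hf : IsSumSq f)
    (y : ι → ℝ) : 0 ≤ eval y f := by
  induction hf with
  | zero => simp
  | sq_add a _ ih => simpa using add_nonneg (mul_self_nonneg (eval y a)) ih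

namespace JointPoly

variable {n p m : ℕ}

theorem continuous_sumElim :
    Continuous fun z : (Fin n → ℝ) × (Fin p → ℝ) => (Sum.elim z.1 z.2 : Fin n ⊕ Fin p → ℝ) := by
  refine continuous_pi fun i => ?_
  rcases i with i | i
  · exact (continuous_apply i).comp continuous_fst
  · exact (continuous_apply i).comp continuous_snd

theorem continuous_evalAt (f : JointPoly n p) :
    Continuous fun z : (Fin n → ℝ) × (Fin p → ℝ) => f.evalAt z.1 z.2 :=
  (MvPolynomial.continuous_eval f).comp continuous_sumElim

theorem isClosed_semialgSet {X : Set (Fin n → ℝ)} {Ω : Set (Fin p → ℝ)} (hX : IsClosed X)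
    (hΩ : IsClosed Ω) (g : Fin m → JointPoly n p) : IsClosed (semialgSet X Ω g) := by
  have e : semialgSet X Ω g = Prod.fst ⁻¹' X ∩ (Prod.snd ⁻¹' Ω ∩
      ⋂ j, {z | 0 ≤ (g j).evalAt z.1 z.2}) := by
    ext z; simp [semialgSet]
  rw [e]
  exact (hX.preimage continuous_fst).inter ((hΩ.preimage continuous_snd).inter
    (isClosed_iInter fun j => isClosed_le continuous_const (continuous_evalAt (g j))))

theorem isCompact_nonneg_of_ball {g : Fin m → JointPoly n p} {j₀ : Fin m} {M : ℝ}
    (hg : g j₀ = MvPolynomial.C M - normSq n p) :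
    IsCompact {y : Fin n ⊕ Fin p → ℝ | ∀ j, 0 ≤ MvPolynomial.eval y (g j)} := by
  refine IsCompact.of_isClosed_subset
    (isCompact_univ_pi fun _ => isCompact_Icc (a := -√M) (b := √M)) ?_ fun y hy i _ => ?_
  · rw [Set.ofPred_forall]
    exact isClosed_iInter fun j => isClosed_le continuous_const (MvPolynomial.continuous_eval _)
  · have h := hy j₀
    simp only [hg, normSq, map_sub, MvPolynomial.eval_C, map_sum, map_pow, MvPolynomial.eval_X,
      sub_nonneg] at h
    have h1 := Finset.single_le_sum (f := fun i => y i ^ 2) (fun i _ => sq_nonneg _)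
      (Finset.mem_univ i)
    exact abs_le.1 (Real.abs_le_sqrt (h1.trans h))

theorem sdpDualFeasible_subset (X : Set (Fin n → ℝ)) (Ω : Set (Fin p → ℝ))
    (g : Fin m → JointPoly n p) (d : ℕ) :
    sdpDualFeasible g d ⊆ dualFeasible (semialgSet X Ω g) d := by
  rintro f ⟨hdeg, hf, σ₀, σ, h₀, -, hσ, e⟩
  refine ⟨hdeg, hf, fun z hz => ?_⟩
  have e' := congrArg (MvPolynomial.eval (Sum.elim z.1 z.2)) e
  simp only [map_sub, map_add, map_one, map_sum, map_mul] at e'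
  have h1 := MvPolynomial.eval_nonneg_of_isSumSq h₀ (Sum.elim z.1 z.2)
  have h2 : 0 ≤ ∑ j, MvPolynomial.eval (Sum.elim z.1 z.2) (σ j) *
      MvPolynomial.eval (Sum.elim z.1 z.2) (g j) :=
    Finset.sum_nonneg fun j _ =>
      mul_nonneg (MvPolynomial.eval_nonneg_of_isSumSq (hσ j).1 _) (hz.2.2 j)
  rw [evalAt]
  linarith

/-- A single certificate has fixed degrees, so it meets every degree bound once `d` is large. -/
theorem eventually_mem_sdpDualFeasible {g : Fin m → JointPoly n p} {f : JointPoly n p}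
    (hf : IsSumSq f) (hfg : f - 1 ∈ quadraticCone g) : ∀ᶠ d in atTop, f ∈ sdpDualFeasible g d := by
  obtain ⟨σ₀, σ, h₀, hσ, e⟩ := hfg
  filter_upwards [eventually_ge_atTop (f.totalDegree + σ₀.totalDegree +
    ∑ j, ((σ j).totalDegree + 2 * (g j).halfDegree))] with d hd
  refine ⟨by omega, hf, σ₀, σ, h₀, by omega, fun j => ⟨hσ j, fun _ => ?_⟩, e⟩
  have := Finset.single_le_sum (f := fun j => (σ j).totalDegree + 2 * (g j).halfDegree)
    (fun _ _ => Nat.zero_le _) (Finset.mem_univ j)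
  omega

/-! ### Integrals against `λ ⊗ μ` and the `L¹` norm of the excess -/

section Measure

variable {X : Set (Fin n → ℝ)} {μ : Measure (Fin p → ℝ)}

theorem restrict_support : μ.restrict μ.support = μ :=
  Measure.restrict_eq_self_of_ae_mem (s := μ.support) Measure.support_mem_ae

theorem ae_mem_prod_support [SFinite μ] (hX : IsCompact X) :
    ∀ᵐ z ∂(volume.restrict X).prod μ, z ∈ X ×ˢ μ.support := by
  have h1 : ∀ᵐ z ∂(volume.restrict X).prod μ, z.1 ∈ X :=
    Measure.quasiMeasurePreserving_fst.ae (ae_restrict_mem hX.measurableSet)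
  have h2 : ∀ᵐ z ∂(volume.restrict X).prod μ, z.2 ∈ μ.support :=
    Measure.quasiMeasurePreserving_snd.ae Measure.support_mem_ae
  filter_upwards [h1, h2] with z hz1 hz2 using ⟨hz1, hz2⟩

variable [IsProbabilityMeasure μ]

theorem integrable_evalAt (hX : IsCompact X) (hΩ : IsCompact μ.support) (f : JointPoly n p) :
    Integrable (fun z => f.evalAt z.1 z.2) ((volume.restrict X).prod μ) := by
  have : IsFiniteMeasure (volume.restrict X) := ⟨by simpa using hX.measure_lt_top⟩
  have := (continuous_evalAt f).continuousOn.integrableOn_compact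
    (μ := (volume.restrict X).prod μ) (hX.prod hΩ)
  rwa [IntegrableOn, Measure.restrict_eq_self_of_ae_mem (ae_mem_prod_support hX)] at this

theorem integrable_evalAt_right (hΩ : IsCompact μ.support) (f : JointPoly n p) (x : Fin n → ℝ) :
    Integrable (fun ω => f.evalAt x ω) μ := by
  have : Continuous fun ω => f.evalAt x ω :=
    (continuous_evalAt f).comp (f := fun ω => (x, ω)) (by fun_prop)
  have := this.continuousOn.integrableOn_compact (μ := μ) hΩ
  rwa [IntegrableOn, restrict_support] at this

/-- The excess of `f` is the marginal of the difference between `f` and the indicator of `K`. -/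
theorem excess_eq_integral (hX : IsCompact X) (hΩ : IsCompact μ.support)
    (g : Fin m → JointPoly n p) (f : JointPoly n p) (x : Fin n → ℝ) :
    excess X μ g f x = ∫ ω, (f.evalAt x ω - (semialgSet X μ.support g).indicator 1 (x, ω)) ∂μ := by
  have hK : IsClosed (semialgSet X μ.support g) :=
    isClosed_semialgSet hX.isClosed Measure.isClosed_support g
  have hfib : fiber μ.support (semialgSet X μ.support g) x
      = Prod.mk x ⁻¹' semialgSet X μ.support g := by
    ext ω
    exact ⟨fun h => h.2, fun h => ⟨h.2.1, h⟩⟩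
  have hmeas : MeasurableSet (Prod.mk x ⁻¹' semialgSet X μ.support g) :=
    hK.measurableSet.preimage measurable_prodMk_left
  have hind : (fun ω => (semialgSet X μ.support g).indicator
      (1 : (Fin n → ℝ) × (Fin p → ℝ) → ℝ) (x, ω))
      = (Prod.mk x ⁻¹' semialgSet X μ.support g).indicator 1 := rfl
  have hint : Integrable ((Prod.mk x ⁻¹' semialgSet X μ.support g).indicator
      (1 : (Fin p → ℝ) → ℝ)) μ := (integrable_const 1).indicator hmeas
  rw [integral_sub (integrable_evalAt_right hΩ f x) (hind ▸ hint), hind, integral_indicator_one hmeas, excess,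
    marginal, hfib, restrict_support]

theorem excess_nonneg (hX : IsCompact X) (hΩ : IsCompact μ.support)
    {g : Fin m → JointPoly n p} {f : JointPoly n p} {d : ℕ}
    (hf : f ∈ dualFeasible (semialgSet X μ.support g) d) (x : Fin n → ℝ) :
    0 ≤ excess X μ g f x := by
  rw [excess_eq_integral hX hΩ]
  refine integral_nonneg fun ω => ?_
  rw [Pi.zero_apply, sub_nonneg]
  by_cases h : (x, ω) ∈ semialgSet X μ.support g
  · rw [Set.indicator_of_mem h]
    exact hf.2.2 (x, ω) h
  · rw [Set.indicator_of_notMem h]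
    exact MvPolynomial.eval_nonneg_of_isSumSq hf.2.1 (Sum.elim x ω)

theorem stronglyMeasurable_excess (hX : IsCompact X) (hΩ : IsCompact μ.support)
    (g : Fin m → JointPoly n p) (f : JointPoly n p) : StronglyMeasurable (excess X μ g f) := by
  have hK : IsClosed (semialgSet X μ.support g) :=
    isClosed_semialgSet hX.isClosed Measure.isClosed_support g
  rw [funext (excess_eq_integral hX hΩ g f)]
  exact ((continuous_evalAt f).stronglyMeasurable.sub
    (stronglyMeasurable_one.indicator hK.measurableSet)).integral_prod_right

theorem integrable_evalAt_sub_indicator (hX : IsCompact X) (hΩ : IsCompact μ.support)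
    (g : Fin m → JointPoly n p) (f : JointPoly n p) :
    Integrable (fun z => f.evalAt z.1 z.2 - (semialgSet X μ.support g).indicator 1 z)
      ((volume.restrict X).prod μ) := by
  have : IsFiniteMeasure (volume.restrict X) := ⟨by simpa using hX.measure_lt_top⟩
  exact (integrable_evalAt hX hΩ f).sub ((integrable_const (1 : ℝ)).indicator
    (isClosed_semialgSet hX.isClosed Measure.isClosed_support g).measurableSet)

theorem integrable_excess (hX : IsCompact X) (hΩ : IsCompact μ.support)
    (g : Fin m → JointPoly n p) (f : JointPoly n p) :
    Integrable (excess X μ g f) (volume.restrict X) := by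
  rw [funext (excess_eq_integral hX hΩ g f)]
  exact (integrable_evalAt_sub_indicator hX hΩ g f).integral_prod_left

theorem integral_excess (hX : IsCompact X) (hΩ : IsCompact μ.support)
    (g : Fin m → JointPoly n p) (f : JointPoly n p) :
    ∫ x in X, excess X μ g f x =
      cost X μ f - ((volume.restrict X).prod μ).real (semialgSet X μ.support g) := by
  have : IsFiniteMeasure (volume.restrict X) := ⟨by simpa using hX.measure_lt_top⟩
  have hK := (isClosed_semialgSet hX.isClosed (Measure.isClosed_support (μ := μ)) g).measurableSet
  have hint : Integrable ((semialgSet X μ.support g).indicator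
      (1 : (Fin n → ℝ) × (Fin p → ℝ) → ℝ)) ((volume.restrict X).prod μ) :=
    (integrable_const 1).indicator hK
  rw [funext (excess_eq_integral hX hΩ g f),
    ← integral_prod _ (integrable_evalAt_sub_indicator hX hΩ g f),
    integral_sub (integrable_evalAt hX hΩ f) hint,
    integral_indicator_one hK, cost]

/-- The optimal values of the semidefinite hierarchy come arbitrarily close to the measure
of `K`. -/
theorem exists_eventually_mem_sdpDualFeasible_cost_le (hX : IsCompact X)
    (hΩ : IsCompact μ.support) {g : Fin m → JointPoly n p} {j₀ : Fin m} {M : ℝ}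
    (hg : g j₀ = MvPolynomial.C M - normSq n p) {ε : ℝ} (hε : 0 < ε) :
    ∃ f : JointPoly n p, (∀ᶠ d in atTop, f ∈ sdpDualFeasible g d) ∧
      cost X μ f ≤ ((volume.restrict X).prod μ).real (semialgSet X μ.support g) + ε := by
  have : IsFiniteMeasure (volume.restrict X) := ⟨by simpa using hX.measure_lt_top⟩
  have hmeas := (continuous_sumElim (n := n) (p := p)).measurable
  have hKg := isCompact_nonneg_of_ball hg
  -- A Putinar certificate sees only the `g j`, so `q ^ 2 > 1` is needed on all of `Kg`, not only
  -- over `X × Ω`. The part of `Kg` outside is `ν`-null and costs nothing.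
  set Kg := {y : Fin n ⊕ Fin p → ℝ | ∀ j, 0 ≤ MvPolynomial.eval y (g j)}
  set ν := ((volume.restrict X).prod μ).map
    fun z : (Fin n → ℝ) × (Fin p → ℝ) => (Sum.elim z.1 z.2 : Fin n ⊕ Fin p → ℝ)
  have hS := (hX.prod hΩ).image (continuous_sumElim (n := n) (p := p))
  have hν : ∀ᵐ y ∂ν, y ∈ (fun z : (Fin n → ℝ) × (Fin p → ℝ) =>
      (Sum.elim z.1 z.2 : Fin n ⊕ Fin p → ℝ)) '' (X ×ˢ μ.support) := by
    refine (ae_map_iff hmeas.aemeasurable hS.measurableSet).2 ?_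
    filter_upwards [ae_mem_prod_support hX] with z hz using Set.mem_image_of_mem _ hz
  have : IsFiniteMeasure ν := Measure.isFiniteMeasure_map _ _
  obtain ⟨q, hq1, hq2⟩ := MvPolynomial.exists_sq_gt_one_integral_le hS hν hKg hε
  refine ⟨q ^ 2, eventually_mem_sdpDualFeasible (sq q ▸ .mul_self q)
    (MvPolynomial.mem_quadraticCone_of_pos hg fun y hy => ?_), ?_⟩
  · simpa [-one_lt_sq_iff_one_lt_abs] using hq1 y hy
  · have h1 : ∫ y, MvPolynomial.eval y (q ^ 2) ∂ν = cost X μ (q ^ 2) :=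
      integral_map hmeas.aemeasurable
        (MvPolynomial.continuous_eval (q ^ 2)).aestronglyMeasurable
    have h2 : ν.real Kg = ((volume.restrict X).prod μ).real (semialgSet X μ.support g) := by
      rw [map_measureReal_apply hmeas hKg.measurableSet]
      refine measureReal_congr ?_
      filter_upwards [ae_mem_prod_support hX] with z hz
      exact propext ⟨fun h => ⟨hz.1, hz.2, h⟩, fun h => h.2.2⟩
    rwa [h1, h2] at hq2

theorem eLpNorm_excess (hX : IsCompact X) (hΩ : IsCompact μ.support)
    {g : Fin m → JointPoly n p} {f : JointPoly n p} {d : ℕ}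
    (hf : f ∈ dualFeasible (semialgSet X μ.support g) d) :
    eLpNorm (excess X μ g f) 1 (volume.restrict X) =
      ENNReal.ofReal (∫ x in X, excess X μ g f x) := by
  rw [eLpNorm_one_eq_lintegral_enorm, ofReal_integral_eq_lintegral_ofReal
    (integrable_excess hX hΩ g f) (.of_forall (excess_nonneg hX hΩ hf))]
  exact lintegral_congr fun x => Real.enorm_of_nonneg (excess_nonneg hX hΩ hf x)

/-- Feasibility is asked in the larger set and optimality only against the smaller one, which covers
optimal solutions of both problems. -/
theorem tendsto_eLpNorm_excess (hX : IsCompact X) (hΩ : IsCompact μ.support)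
    {g : Fin m → JointPoly n p} {j₀ : Fin m} {M : ℝ}
    (hg : g j₀ = MvPolynomial.C M - normSq n p) {P : ℕ → JointPoly n p}
    (hP : ∀ d, P d ∈ dualFeasible (semialgSet X μ.support g) d)
    (hle : ∀ d, ∀ q ∈ sdpDualFeasible g d, cost X μ (P d) ≤ cost X μ q) :
    Tendsto (fun d => eLpNorm (excess X μ g (P d)) 1 (volume.restrict X)) atTop (𝓝 0) := by
  simp only [fun d => eLpNorm_excess hX hΩ (hP d)]
  rw [← ENNReal.ofReal_zero]
  refine ENNReal.tendsto_ofReal (Metric.tendsto_atTop'.2 fun ε hε => ?_)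
  obtain ⟨f, hf, hfc⟩ := exists_eventually_mem_sdpDualFeasible_cost_le hX hΩ hg (half_pos hε)
  obtain ⟨D, hD⟩ := eventually_atTop.1 hf
  refine ⟨D, fun d hd => ?_⟩
  have h0 : 0 ≤ ∫ x in X, excess X μ g (P d) x := integral_nonneg (excess_nonneg hX hΩ (hP d))
  rw [Real.dist_eq, sub_zero, abs_of_nonneg h0, integral_excess hX hΩ]
  linarith [hle d f (hD d hd.le)]

end Measure

end JointPoly

theorem corollary1 {n p m : ℕ} (X : Set (Fin n → ℝ)) (hX : IsCompact X)
    (μ : Measure (Fin p → ℝ)) [IsProbabilityMeasure μ] (hΩ : IsCompact μ.support)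
    (g : Fin m → JointPoly n p)
    (hg : ∃ (j : Fin m) (M : ℝ), 0 < M ∧ g j = MvPolynomial.C M - JointPoly.normSq n p)
    (P : ℕ → JointPoly n p)
    (hP : (∀ d, JointPoly.IsOptimal X μ
              (JointPoly.dualFeasible (JointPoly.semialgSet X μ.support g) d) (P d)) ∨
          (∀ d, JointPoly.IsOptimal X μ (JointPoly.sdpDualFeasible g d) (P d))) :
    -- nonnegativity on `X`
    (∀ d, ∀ x ∈ X, 0 ≤ JointPoly.excess X μ g (P d) x) ∧
    -- convergence to `0` in `L¹(X, λ)`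
    ((∀ d, MemLp (JointPoly.excess X μ g (P d)) 1 (volume.restrict X)) ∧
      Tendsto (fun d => eLpNorm (JointPoly.excess X μ g (P d)) 1 (volume.restrict X))
        atTop (𝓝 0)) ∧
    -- convergence to `0` in `λ`-measure
    TendstoInMeasure (volume.restrict X) (fun d => JointPoly.excess X μ g (P d)) atTop
      (fun _ => (0 : ℝ)) ∧
    -- `λ`-almost uniform convergence to `0` along a subsequence
    (∃ s : ℕ → ℕ, StrictMono s ∧
      ∀ ε : ℝ, 0 < ε → ∃ B ⊆ X, MeasurableSet B ∧ volume.restrict X B < ENNReal.ofReal ε ∧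
        TendstoUniformlyOn (fun k => JointPoly.excess X μ g (P (s k))) (fun _ => (0 : ℝ))
          atTop (X \ B)) := by
  have : IsFiniteMeasure (volume.restrict X) := ⟨by simpa using hX.measure_lt_top⟩
  obtain ⟨j₀, M, -, hg⟩ := hg
  have hfeas : ∀ d, P d ∈ JointPoly.dualFeasible (JointPoly.semialgSet X μ.support g) d := fun d =>
    hP.elim (fun h => (h d).1) fun h => JointPoly.sdpDualFeasible_subset X μ.support g d (h d).1
  have hle : ∀ d, ∀ q ∈ JointPoly.sdpDualFeasible g d,
      JointPoly.cost X μ (P d) ≤ JointPoly.cost X μ q := fun d q hq =>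
    hP.elim (fun h => (h d).2 q (JointPoly.sdpDualFeasible_subset X μ.support g d hq))
      fun h => (h d).2 q hq
  have hmeas := fun d => JointPoly.stronglyMeasurable_excess hX hΩ g (P d)
  have hlim := JointPoly.tendsto_eLpNorm_excess hX hΩ hg hfeas hle
  have hinmeas : TendstoInMeasure (volume.restrict X) (fun d => JointPoly.excess X μ g (P d)) atTop
      (fun _ => (0 : ℝ)) :=
    tendstoInMeasure_of_tendsto_eLpNorm one_ne_zero (fun d => (hmeas d).aestronglyMeasurable)
      aestronglyMeasurable_const (hlim.congr fun d => by
        congr 1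
        ext x
        simp)
  refine ⟨fun d x _ => JointPoly.excess_nonneg hX hΩ (hfeas d) x,
    ⟨fun d => memLp_one_iff_integrable.2 (JointPoly.integrable_excess hX hΩ g (P d)), hlim⟩,
    hinmeas, ?_⟩
  obtain ⟨s, hs, hae⟩ := hinmeas.exists_seq_tendsto_ae
  refine ⟨s, hs, fun ε hε => ?_⟩
  -- Egorov's theorem bounds the exceptional set only by `≤`; taking `ε / 2` makes the inequality
  -- strict.
  obtain ⟨t, ht, htε, hunif⟩ := tendstoUniformlyOn_of_ae_tendsto' (fun k => hmeas (s k))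
    stronglyMeasurable_const hae (half_pos hε)
  refine ⟨X ∩ t, Set.inter_subset_left, hX.measurableSet.inter ht, ?_, hunif.mono ?_⟩
  · calc volume.restrict X (X ∩ t) ≤ volume.restrict X t := measure_mono Set.inter_subset_right
      _ ≤ ENNReal.ofReal (ε / 2) := htε
      _ < ENNReal.ofReal ε := (ENNReal.ofReal_lt_ofReal_iff hε).2 (half_lt_self hε)
  · exact fun x hx hxt => hx.2 ⟨hx.1, hxt⟩
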